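/- For $P=(x,y)$ in $\mathbb{C}^2$ or $\mathbb{R}^2$ let $d(P)=x^2+y^2$. Let $G=(V,E)$ be a finite simple graph. A complex (real) realisation of $G$ is a map $p$ from $V$ to $\mathbb{C}^2$ (to $\mathbb{R}^2$). It is generic if the family of its $2|V|$ coordinates is algebraically independent over $\mathbb{Q}$. Realisations $p,q$ are equivalent if $d(p(u)-p(v))=d(q(u)-q(v))$ for all $uv\in E$, and congruent if this holds for all $u,v\in V$. A real realisation $p$ is rigid if there is an $\varepsilon>0$ such that every real realisation $q$ that is equivalent to $p$ and satisfies $d(p(v)-q(v))<\varepsilon$ for all $v\in V$ is congruent to $p$. The graph $G$ is rigid if some (equivalently, every) generic real realisation of $G$ is rigid. **Theorem.** Let $G$ be a rigid graph. For every generic complex realisation $p$ of $G$, the set of all complex realisations of $G$ that are equivalent to $p$ consists of finitely many congruence classes. Moreover, the number of these classes is the same for all generic complex realisations $p$ of $G$; that is, there is a unique natural number $c(G)$ such that, for every generic complex realisation $p$ of $G$, this number equals $c(G)$. -/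

import Mathlib

namespace Framework

/-- A realisation over `K` of a graph with vertex set `V`: a map from `V` to `K²`.
Real realisations are the case `K = ℝ`, complex realisations the case `K = ℂ`. -/
abbrev Realisation (K : Type*) (V : Type*) := V → Fin 2 → K

/-- `d (x, y) = x² + y²`. -/
def d {K : Type*} [Field K] (P : Fin 2 → K) : K := P 0 ^ 2 + P 1 ^ 2

/-- A realisation is generic if the family of its `2|V|` coordinates is algebraically
independent over `ℚ`. -/
def IsGeneric {K : Type*} [Field K] [CharZero K] {V : Type*} (p : Realisation K V) : Prop :=
  AlgebraicIndependent ℚ (fun c : V × Fin 2 => p c.1 c.2)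

/-- `(G, p)` and `(G, q)` are equivalent: corresponding edges have the same `d`. -/
def Equivalent {K : Type*} [Field K] {V : Type*} (G : SimpleGraph V)
    (p q : Realisation K V) : Prop :=
  ∀ u v : V, G.Adj u v → d (p u - p v) = d (q u - q v)

/-- `p` and `q` are congruent: all pairs of vertices have the same `d`. -/
def Congruent {K : Type*} [Field K] {V : Type*} (p q : Realisation K V) : Prop :=
  ∀ u v : V, d (p u - p v) = d (q u - q v)

/-- A real framework `(G, p)` is rigid if every equivalent real framework that is sufficiently
close to it is congruent to it. -/
def IsRigidFramework {V : Type*} (G : SimpleGraph V) (p : Realisation ℝ V) : Prop :=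
  ∃ ε : ℝ, 0 < ε ∧ ∀ q : Realisation ℝ V,
    Equivalent G p q → (∀ v : V, d (p v - q v) < ε) → Congruent p q

/-- A graph is rigid if some generic real realisation of it is rigid. (It is then known that
every generic real realisation is rigid; asking for one is formally the weaker requirement,
since generic real realisations of a finite graph exist.) -/
def IsRigid {V : Type*} (G : SimpleGraph V) : Prop :=
  ∃ p : Realisation ℝ V, IsGeneric p ∧ IsRigidFramework G p

/-- The set `S` of all complex realisations of `G` that are equivalent to `(G, p)`. -/
def equivalentRealisations {V : Type*} (G : SimpleGraph V) (p : Realisation ℂ V) :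
    Set (Realisation ℂ V) :=
  {q | Equivalent G p q}

/-- Congruence, as an equivalence relation on the set of realisations equivalent to `(G, p)`. -/
def congruenceSetoid {V : Type*} (G : SimpleGraph V) (p : Realisation ℂ V) :
    Setoid (equivalentRealisations G p) where
  r q q' := Congruent q.1 q'.1
  iseqv :=
    { refl := fun _ _ _ => rfl
      symm := fun h u v => (h u v).symm
      trans := fun h h' u v => (h u v).trans (h' u v) }

/-- The type of congruence classes in the set of complex realisations equivalent to `(G, p)`. -/
def CongruenceClasses {V : Type*} (G : SimpleGraph V) (p : Realisation ℂ V) : Type _ :=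
  Quotient (congruenceSetoid G p)

/-- `c(G, p)`: the number of congruence classes in the set of complex realisations equivalent
to `(G, p)` (meaningful when there are finitely many). -/
noncomputable def numClasses {V : Type*} (G : SimpleGraph V) (p : Realisation ℂ V) : ℕ :=
  Nat.card (CongruenceClasses G p)

end Framework

open MvPolynomial Filter Topology

namespace Framework

/-! ### Algebraic dependence and generic points -/

/-! The key is that in a rigid graph every squared distance is algebraic over the ℚ-algebra
generated by the edge polynomials. Otherwise a transcendence basis `B` of those polynomials together
with some squared distance `f` is independent, also after evaluation at a generic real point. The
Jacobian of `insert f B` then has full rank there, so `f` can move while `B` stays fixed; the other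
edge lengths, algebraic over `B`, stay constant nearby, against rigidity. This algebraicity does not
mention ℝ, so over ℂ it confines each squared distance to finitely many values, and these distances
determine the congruence class. The count is constant because any two generic realisations are
conjugate under a field automorphism of ℂ. -/

/-- A polynomial `f` that is algebraic over the algebra generated by `s` takes only finitely many
values on the fibre of `s` through a generic point. -/
theorem exists_finite_values_of_isAlgebraic {ι k L : Type*} [Field k] [Field L] [Algebra k L]
    {s : Set (MvPolynomial ι k)} {f : MvPolynomial ι k}
    (hf : IsAlgebraic (Algebra.adjoin k s) f) {p : ι → L} (hp : AlgebraicIndependent k p) :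
    ∃ T : Set L, T.Finite ∧
      ∀ q : ι → L, (∀ g ∈ s, aeval q g = aeval p g) → aeval q f ∈ T := by
  obtain ⟨P, hP, hPf⟩ := hf
  let φ : (ι → L) → Algebra.adjoin k s →+* L := fun q =>
    ((aeval q : MvPolynomial ι k →ₐ[k] L).comp (Algebra.adjoin k s).val).toRingHom
  have hφ : Function.Injective (φ p) :=
    (algebraicIndependent_iff_injective_aeval.1 hp).comp Subtype.val_injective
  -- Only `p` has to be generic: `q` gives the same specialised polynomial, since the coefficients
  -- of `P` are built from `s`.
  have hPp : P.map (φ p) ≠ 0 := (Polynomial.map_ne_zero_iff hφ).2 hP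
  refine ⟨{z | (P.map (φ p)).IsRoot z}, Polynomial.finite_setOfPred_isRoot hPp, fun q hq => ?_⟩
  have hpq : φ p = φ q := by
    ext a
    exact (AlgHom.eqOn_adjoin_iff.2 (fun g hg => (hq g hg).symm) :
      Set.EqOn (aeval p : MvPolynomial ι k →ₐ[k] L) (aeval q) _) a.2
  have h := congrArg (aeval q : MvPolynomial ι k →ₐ[k] L) hPf
  rw [Polynomial.aeval_def, map_zero] at h
  change Polynomial.eval (aeval q f) (P.map (φ p)) = 0
  rw [hpq, Polynomial.eval_map, ← h]
  exact (Polynomial.hom_eval₂ P (algebraMap _ _)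
    (aeval q : MvPolynomial ι k →ₐ[k] L).toRingHom f).symm

/-- Over a field of characteristic zero, a transcendence basis admits derivations with
arbitrary prescribed values. -/
theorem _root_.IsTranscendenceBasis.exists_derivation {ι k K : Type*} [Field k] [CharZero k]
    [Field K] [Algebra k K] {x : ι → K} (hx : IsTranscendenceBasis k x) (c : ι → K) :
    ∃ D : Derivation k K K, ∀ i, D (x i) = c i := by
  let A := MvPolynomial ι k
  have hinj := algebraicIndependent_iff_injective_aeval.1 hx.1
  let : Algebra A K := (aeval x : A →ₐ[k] K).toRingHom.toAlgebra
  have hAK : ∀ a : A, algebraMap A K a = aeval x a := fun _ => rfl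
  have : IsScalarTower k A K := IsScalarTower.of_algebraMap_eq fun r => by
    rw [hAK, MvPolynomial.algebraMap_eq, aeval_C]
  have : FaithfulSMul A K := (faithfulSMul_iff_algebraMap_injective A K).2 hinj
  let := FractionRing.liftAlgebra A K
  have := hx.isAlgebraic
  have : Algebra.IsAlgebraic A K :=
    Algebra.IsAlgebraic.of_ringHom_of_comp_eq (hx.1.aevalEquiv : A ≃ₐ[k] _) (RingHom.id K)
      hx.1.aevalEquiv.surjective Function.injective_id (by ext <;> simp [hAK])
  have : Algebra.IsAlgebraic (FractionRing A) K :=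
    (IsFractionRing.comap_isAlgebraic_iff (A := A)).1 inferInstance
  -- Localisation is formally étale, and so is a separable algebraic extension; hence `K` is
  -- formally étale over `A`, and the derivation `D₀` on polynomials extends to `K`.
  have : CharZero (FractionRing A) := algebraRat.charZero _
  have : Algebra.FormallyEtale (FractionRing A) K := Algebra.FormallyEtale.of_isSeparable _ _
  have : Algebra.FormallyEtale A (FractionRing A) :=
    Algebra.FormallyEtale.of_isLocalization (nonZeroDivisors A)
  have : Algebra.FormallyEtale A K := Algebra.FormallyEtale.comp A (FractionRing A) K
  let D₀ : Derivation k A K := mkDerivation k c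
  let e := KaehlerDifferential.tensorKaehlerEquivOfFormallyEtale k A K
  let l : TensorProduct A K (Ω[A⁄k]) →ₗ[K] K := D₀.liftKaehlerDifferential.liftBaseChange K
  refine ⟨(l ∘ₗ e.symm.toLinearMap).compDer (KaehlerDifferential.D k K), fun i => ?_⟩
  have hi : x i = algebraMap A K (X i) := by rw [hAK, aeval_X]
  have := KaehlerDifferential.tensorKaehlerEquivOfFormallyEtale_symm_D_algebraMap k A K (X i)
  simp only [Derivation.coe_comp, Function.comp_apply, LinearMap.coe_comp, hi, e,
    LinearEquiv.coe_coe, LinearMap.coe_restrictScalars]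
  erw [this]
  simp only [l, LinearMap.liftBaseChange_tmul, Derivation.liftKaehlerDifferential_comp_D, one_smul]
  exact mkDerivation_X k c i

/-- Enlarge `x` to a transcendence basis; the values on the added elements are irrelevant and set to
0. -/
theorem _root_.AlgebraicIndependent.exists_derivation {ι k K : Type*} [Field k] [CharZero k]
    [Field K] [Algebra k K] {x : ι → K} (hx : AlgebraicIndependent k x) (c : ι → K) :
    ∃ D : Derivation k K K, ∀ i, D (x i) = c i := by
  obtain ⟨t, hst, ht⟩ := exists_isTranscendenceBasis_superset hx.to_subtype_range
  obtain ⟨D, hD⟩ := ht.exists_derivation fun i => Function.extend x c 0 i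
  exact ⟨D, fun i => (hD ⟨x i, hst ⟨i, rfl⟩⟩).trans (hx.injective.extend_apply c 0 i)⟩

/-- The chain rule, which turns a derivation with prescribed values into a preimage under the
Jacobian. -/
theorem _root_.Derivation.map_mvPolynomial_aeval {ι k K : Type*} [Fintype ι] [CommRing k]
    [CommRing K] [Algebra k K] (D : Derivation k K K) (p : ι → K) (f : MvPolynomial ι k) :
    D (aeval p f) = ∑ i, aeval p (pderiv i f) * D (p i) := by
  classical
  induction f using MvPolynomial.induction_on with
  | C a => simp
  | add f g hf hg => simp [hf, hg, add_mul, Finset.sum_add_distrib]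
  | mul_X f j hf =>
    simp only [map_mul, aeval_X, Derivation.leibniz, hf, smul_eq_mul, pderiv_X, map_add, add_mul,
      Finset.sum_add_distrib, Finset.mul_sum]
    congr 1
    · rw [Finset.sum_eq_single j]
      · simp
      · intro i _ hij; simp [hij.symm]
      · simp
    · exact Finset.sum_congr rfl fun i _ => by ring

theorem hasStrictFDerivAt_aeval {ι k 𝕜 : Type*} [Fintype ι] [CommRing k]
    [NontriviallyNormedField 𝕜] [Algebra k 𝕜] (p : ι → 𝕜) (f : MvPolynomial ι k) :
    HasStrictFDerivAt (fun q : ι → 𝕜 => aeval q f)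
      (∑ i, aeval p (pderiv i f) • ContinuousLinearMap.proj (R := 𝕜) (φ := fun _ : ι => 𝕜) i) p := by
  classical
  induction f using MvPolynomial.induction_on with
  | C a => 
    simp only [aeval_C]
    exact (hasStrictFDerivAt_const (𝕜 := 𝕜) (algebraMap k 𝕜 a) p).congr_fderiv (by ext v; simp)
  | add f g hf hg =>
    simp only [map_add]
    exact (hf.add hg).congr_fderiv (by ext v; simp [add_mul, Finset.sum_add_distrib])
  | mul_X f j hf =>
    have hj : HasStrictFDerivAt (fun q : ι → 𝕜 => q j) (ContinuousLinearMap.proj j) p :=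
      (ContinuousLinearMap.proj (R := 𝕜) (φ := fun _ : ι => 𝕜) j).hasStrictFDerivAt
    simp only [map_mul, aeval_X]
    refine (hf.mul hj).congr_fderiv ?_
    ext v
    simp only [_root_.add_apply, _root_.smul_apply,
      _root_.sum_apply, ContinuousLinearMap.proj_apply, smul_eq_mul,
      Derivation.leibniz, pderiv_X, map_add, map_mul, aeval_X, add_mul,
      Finset.sum_add_distrib, Finset.mul_sum]
    congr 1
    · rw [Finset.sum_eq_single j]
      · simp
      · intro i _ hij; simp [hij.symm]
      · simp
    · exact Finset.sum_congr rfl fun i _ => by ring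

/-- Algebraically independent real polynomial values vary freely near the given point. -/
theorem map_nhds_aeval_of_algebraicIndependent {ι σ : Type*} [Finite ι] [Finite σ]
    (F : σ → MvPolynomial ι ℚ) {p : ι → ℝ}
    (hF : AlgebraicIndependent ℚ fun j => aeval p (F j)) :
    map (fun (q : ι → ℝ) j => aeval q (F j)) (𝓝 p) = 𝓝 fun j => aeval p (F j) := by
  cases nonempty_fintype ι
  cases nonempty_fintype σ
  have h := hasStrictFDerivAt_pi.2 fun j => hasStrictFDerivAt_aeval p (F j)
  refine h.map_nhds_eq_of_surj (LinearMap.range_eq_top.2 fun c => ?_)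
  obtain ⟨D, hD⟩ := hF.exists_derivation c
  refine ⟨fun i => D (p i), funext fun j => ?_⟩
  rw [← hD j, D.map_mvPolynomial_aeval]
  simp

/-- If near a generic real point the value of `f` is determined by the values of the polynomials
in `s`, then `f` is algebraic over the algebra generated by `s`. -/
theorem isAlgebraic_adjoin_of_locally_determined {ι : Type*} [Finite ι]
    {s : Set (MvPolynomial ι ℚ)} (hs : s.Finite) {f : MvPolynomial ι ℚ} {p : ι → ℝ}
    (hp : AlgebraicIndependent ℚ p)
    (h : ∀ᶠ q in 𝓝 p, (∀ g ∈ s, aeval q g = aeval p g) → aeval q f = aeval p f) :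
    IsAlgebraic (Algebra.adjoin ℚ s) f := by
  classical
  -- `B` is a maximal algebraically independent subset of `s`.
  obtain ⟨B, hB⟩ := (AlgebraicIndependent.matroid ℚ (MvPolynomial ι ℚ)).exists_isBasis s
  rw [← AlgebraicIndependent.isAlgebraic_adjoin_iff_of_matroid_isBasis hB]
  obtain ⟨hBind, hBs, hsB⟩ := AlgebraicIndependent.matroid_isBasis_iff.1 hB
  by_contra hf
  have hfB : f ∉ B := fun hfB =>
    hf (isAlgebraic_algebraMap (⟨f, Algebra.subset_adjoin hfB⟩ : Algebra.adjoin ℚ B))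
  have hins : AlgebraicIndepOn ℚ id (insert f B) := hBind.insert (by rwa [Set.image_id])
  have : Finite ↥(insert f B) := ((hs.subset hBs).insert f).to_subtype
  have hF : AlgebraicIndependent ℚ fun j : ↥(insert f B) =>
      aeval p (j : MvPolynomial ι ℚ) :=
    hins.map' (algebraicIndependent_iff_injective_aeval.1 hp)
  have hnear : ∀ᶠ q in 𝓝 p, (∀ g ∈ B, aeval q g = aeval p g) → aeval q f = aeval p f := by
    -- With `B` fixed, `g` takes finitely many values, so by continuity it cannot jump near `p`.
    have hfix : ∀ g ∈ s, ∀ᶠ q in 𝓝 p,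
        (∀ b ∈ B, aeval q b = aeval p b) → aeval q g = aeval p g := fun g hg => by
      obtain ⟨T, hT, hTq⟩ := exists_finite_values_of_isAlgebraic (hsB g hg) hp
      have hcont : ContinuousAt (fun q : ι → ℝ => aeval q g) p := by
        cases nonempty_fintype ι
        exact (hasStrictFDerivAt_aeval p g).continuousAt
      filter_upwards [hcont ((hT.subset Set.sdiff_subset).isClosed.isOpen_compl.mem_nhds
        (by simp : aeval p g ∈ (T \ {aeval p g})ᶜ))] with q hq hqB
      by_contra hne
      exact hq ⟨hTq q hqB, hne⟩
    filter_upwards [h, (eventually_all_finite hs).2 hfix] with q h₁ h₂ hqB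
    exact h₁ fun g hg => h₂ g hg hqB
  have himage := image_mem_map (m := fun (q : ι → ℝ) (j : ↥(insert f B)) =>
    aeval q (j : MvPolynomial ι ℚ)) hnear
  rw [map_nhds_aeval_of_algebraicIndependent _ hF] at himage
  let f' : ↥(insert f B) := ⟨f, Set.mem_insert _ _⟩
  -- Perturb the `f`-coordinate alone; by openness, some `t ≠ 0` is attained at a point `q`
  -- satisfying `hnear`.
  let y : ℝ → ↥(insert f B) → ℝ := fun t => Function.update (fun j => aeval p (j : MvPolynomial ι ℚ))
    f' (aeval p f + t)
  have hy : Tendsto y (𝓝[≠] 0) (𝓝 fun j : ↥(insert f B) => aeval p (j : MvPolynomial ι ℚ)) := by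
    have hcont : Continuous y := continuous_const.update _ (continuous_const.add continuous_id)
    have h0 : y 0 = fun j : ↥(insert f B) => aeval p (j : MvPolynomial ι ℚ) := by simp [y, f']
    rw [← h0]
    exact hcont.continuousAt.mono_left nhdsWithin_le_nhds
  obtain ⟨t, ⟨q, hq, hqt⟩, ht⟩ := ((hy.eventually himage).and self_mem_nhdsWithin).exists
  have hqB : ∀ b ∈ B, aeval q b = aeval p b := fun b hb => by
    have := congrFun hqt ⟨b, Set.mem_insert_of_mem _ hb⟩
    have hne : (⟨b, Set.mem_insert_of_mem _ hb⟩ : ↥(insert f B)) ≠ f' := fun e =>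
      hfB (by rwa [← show b = f from Subtype.ext_iff.1 e])
    simpa [y, Function.update_of_ne hne] using this
  have hqf : aeval q f = aeval p f + t := by
    simpa [y, f'] using congrFun hqt f'
  exact ht (by simpa [hqf] using hq hqB)

/-! ### Automorphisms of algebraically closed fields -/

/-- Both fields are algebraic closures of isomorphic polynomial algebras, and the isomorphism lifts.
-/
theorem _root_.IsTranscendenceBasis.exists_ringEquiv {ι R K L : Type*} [CommRing R] [Field K]
    [Field L] [Algebra R K] [Algebra R L] [IsAlgClosed K] [IsAlgClosed L] {v : ι → K} {w : ι → L}
    (hv : IsTranscendenceBasis R v) (hw : IsTranscendenceBasis R w) :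
    ∃ σ : K ≃+* L, ∀ i, σ (v i) = w i := by
  let := IsAlgClosed.isAlgClosure_of_transcendence_basis v hv
  let := IsAlgClosed.isAlgClosure_of_transcendence_basis w hw
  let e := (hv.1.aevalEquiv.symm.trans hw.1.aevalEquiv).toRingEquiv
  refine ⟨IsAlgClosure.equivOfEquiv K L e, fun i => ?_⟩
  have hv' : v i = algebraMap (Algebra.adjoin R (Set.range v)) K (hv.1.aevalEquiv (X i)) := by
    rw [AlgebraicIndependent.algebraMap_aevalEquiv, aeval_X]
  rw [hv', IsAlgClosure.equivOfEquiv_algebraMap]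
  simp [e]

/-- Two finite algebraically independent families in an algebraically closed field are related
by a field automorphism. -/
theorem _root_.AlgebraicIndependent.exists_ringEquiv {ι k K : Type*} [Finite ι] [Field k]
    [Field K] [Algebra k K] [IsAlgClosed K] {p q : ι → K} (hp : AlgebraicIndependent k p)
    (hq : AlgebraicIndependent k q) : ∃ σ : K ≃+* K, ∀ i, σ (p i) = q i := by
  obtain ⟨s, hps, hs⟩ := exists_isTranscendenceBasis_superset hp.to_subtype_range
  obtain ⟨t, hqt, ht⟩ := exists_isTranscendenceBasis_superset hq.to_subtype_range
  have hst : Nonempty (s ≃ t) := Cardinal.eq.1 (hs.cardinalMk_eq ht)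
  let P : ι → s := fun i => ⟨p i, hps ⟨i, rfl⟩⟩
  let Q : ι → t := fun i => ⟨q i, hqt ⟨i, rfl⟩⟩
  have hP : Function.Injective P := fun i j h => hp.injective (congrArg Subtype.val h)
  have hQ : Function.Injective Q := fun i j h => hq.injective (congrArg Subtype.val h)
  let f : Set.range P ↪ t :=
    (Equiv.ofInjective P hP).symm.toEmbedding.trans ⟨Q, hQ⟩
  -- The assignment `p i ↦ q i` extends to a bijection of the bases: they are equipotent, and if
  -- infinite they exceed the finite range of `P`.
  obtain ⟨g, hg⟩ : ∃ g : s ≃ t, ∀ x : Set.range P, g x = f x := by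
    cases finite_or_infinite s
    · exact Cardinal.extend_function_finite f hst
    · exact Cardinal.extend_function_of_lt f
        ((Cardinal.mk_lt_aleph0_iff.2 (Set.finite_range P).to_subtype).trans_le
          (Cardinal.aleph0_le_mk s)) hst
  obtain ⟨σ, hσ⟩ := hs.exists_ringEquiv (ht.comp_equiv g)
  refine ⟨σ, fun i => (hσ (P i)).trans ?_⟩
  have := hg ⟨P i, i, rfl⟩
  simp only [Function.comp_apply, this]
  simp [f, Q]

/-! ### Realisations -/

/-- The polynomial in the coordinates of a realisation whose value is `d (p u - p v)`. -/
noncomputable def sqDistPoly {V : Type*} (u v : V) : MvPolynomial (V × Fin 2) ℚ :=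
  (X (u, 0) - X (v, 0)) ^ 2 + (X (u, 1) - X (v, 1)) ^ 2

/-- The squared distance polynomials of the edges of `G`. -/
def edgePolys {V : Type*} (G : SimpleGraph V) : Set (MvPolynomial (V × Fin 2) ℚ) :=
  {f | ∃ u v, G.Adj u v ∧ sqDistPoly u v = f}

theorem finite_edgePolys {V : Type*} [Finite V] (G : SimpleGraph V) : (edgePolys G).Finite :=
  (Set.finite_range fun c : V × V => sqDistPoly c.1 c.2).subset <| by
    rintro _ ⟨u, v, -, rfl⟩
    exact ⟨(u, v), rfl⟩

theorem aeval_sqDistPoly {K V : Type*} [Field K] [CharZero K] (p : Realisation K V) (u v : V) :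
    aeval (fun c : V × Fin 2 => p c.1 c.2) (sqDistPoly u v) = d (p u - p v) := by
  simp [sqDistPoly, d]

theorem Equivalent.aeval_eq {K V : Type*} [Field K] [CharZero K] {G : SimpleGraph V}
    {p q : Realisation K V} (h : Equivalent G p q) :
    ∀ g ∈ edgePolys G, aeval (fun c : V × Fin 2 => q c.1 c.2) g = aeval (fun c => p c.1 c.2) g := by
  rintro _ ⟨u, v, huv, rfl⟩
  rw [aeval_sqDistPoly, aeval_sqDistPoly, h u v huv]

/-- In a rigid graph every squared distance is algebraic over the edge lengths. -/
theorem IsRigid.isAlgebraic_sqDistPoly {V : Type*} [Finite V] {G : SimpleGraph V}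
    (hG : IsRigid G) (u v : V) :
    IsAlgebraic (Algebra.adjoin ℚ (edgePolys G)) (sqDistPoly u v) := by
  obtain ⟨p, hp, ε, hε, hrigid⟩ := hG
  refine isAlgebraic_adjoin_of_locally_determined (finite_edgePolys G) hp ?_
  have hclose : ∀ᶠ q : V × Fin 2 → ℝ in 𝓝 fun c => p c.1 c.2,
      ∀ w : V, d (p w - fun i => q (w, i)) < ε := by
    refine eventually_all.2 fun w => ?_
    have hcont : Continuous fun q : V × Fin 2 → ℝ => d (p w - fun i => q (w, i)) := by
      simp only [d, Pi.sub_apply]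
      fun_prop
    exact hcont.continuousAt.eventually_lt_const (by simpa [d] using hε)
  filter_upwards [hclose] with q hq hqs
  let r : Realisation ℝ V := fun w i => q (w, i)
  have hr : q = fun c => r c.1 c.2 := rfl
  rw [hr] at hqs ⊢
  rw [aeval_sqDistPoly, aeval_sqDistPoly]
  refine (hrigid r (fun a b hab => ?_) hq u v).symm
  have := hqs _ ⟨a, b, hab, rfl⟩
  rw [aeval_sqDistPoly, aeval_sqDistPoly] at this
  exact this.symm

/-- The vector of all squared distances embeds the classes into a finite product of finite sets. -/
theorem IsRigid.finite_congruenceClasses {V : Type*} [Finite V] {G : SimpleGraph V}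
    (hG : IsRigid G) {p : Realisation ℂ V} (hp : IsGeneric p) : Finite (CongruenceClasses G p) := by
  choose T hT hTq using fun c : V × V =>
    exists_finite_values_of_isAlgebraic (hG.isAlgebraic_sqDistPoly c.1 c.2) hp
  let φ : CongruenceClasses G p → V × V → ℂ :=
    Quotient.lift (fun q c => d (q.1 c.1 - q.1 c.2)) fun q q' h => funext fun c => h c.1 c.2
  have hφ : Function.Injective φ := by
    rintro ⟨q⟩ ⟨q'⟩ h
    exact Quotient.sound fun u v => congrFun h (u, v)
  refine Set.finite_univ_iff.1 (((Set.Finite.pi hT).subset ?_).of_finite_image (f := φ) hφ.injOn)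
  rintro _ ⟨⟨q⟩, -, rfl⟩ c -
  have := hTq c (fun c => q.1 c.1 c.2) (Equivalent.aeval_eq q.2)
  rwa [aeval_sqDistPoly] at this

theorem d_map {K L : Type*} [Field K] [Field L] (σ : K →+* L) (P Q : Fin 2 → K) :
    d ((fun i => σ (P i)) - fun i => σ (Q i)) = σ (d (P - Q)) := by
  simp [d]

/-- Applying a field automorphism to all coordinates preserves congruence classes. -/
def congruenceClassesEquiv {V : Type*} {G : SimpleGraph V} {p q : Realisation ℂ V}
    (σ : ℂ ≃+* ℂ) (h : ∀ v i, σ (p v i) = q v i) :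
    CongruenceClasses G p ≃ CongruenceClasses G q :=
  have hd (r : Realisation ℂ V) (u v : V) :
      d ((fun i => σ (r u i)) - fun i => σ (r v i)) = σ (d (r u - r v)) :=
    d_map (σ : ℂ →+* ℂ) (r u) (r v)
  have hq : q = fun v i => σ (p v i) := funext fun v => funext fun i => (h v i).symm
  let e : Realisation ℂ V ≃ Realisation ℂ V :=
    Equiv.piCongrRight fun _ => Equiv.piCongrRight fun _ => σ.toEquiv
  have he (r : Realisation ℂ V) (v : V) : e r v = fun i => σ (r v i) := rfl
  Quotient.congr
    (e.subtypeEquiv fun r => forall₃_congr fun u v _ => by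
      rw [he, he, hd, hq, hd, σ.injective.eq_iff] :
      equivalentRealisations G p ≃ equivalentRealisations G q)
    fun r r' => forall₂_congr fun u v => by
      change _ ↔ d (e r.1 u - e r.1 v) = d (e r'.1 u - e r'.1 v)
      rw [he, he, he, he, hd, hd, σ.injective.eq_iff]

theorem IsGeneric.numClasses_eq {V : Type*} [Finite V] (G : SimpleGraph V) {p q : Realisation ℂ V}
    (hp : IsGeneric p) (hq : IsGeneric q) : numClasses G p = numClasses G q := by
  obtain ⟨σ, hσ⟩ := AlgebraicIndependent.exists_ringEquiv hp hq
  exact Nat.card_congr (congruenceClassesEquiv σ fun v i => hσ (v, i))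

theorem IsGeneric.ofReal {V : Type*} {p : Realisation ℝ V} (hp : IsGeneric p) :
    IsGeneric fun v i => (p v i : ℂ) :=
  AlgebraicIndependent.map' (f := Complex.ofRealAm.restrictScalars ℚ) hp Complex.ofReal_injective

end Framework

theorem theorem5 {V : Type*} [Finite V] (G : SimpleGraph V) (hG : Framework.IsRigid G) :
    (∀ p : Framework.Realisation ℂ V, Framework.IsGeneric p →
      Finite (Framework.CongruenceClasses G p)) ∧
    ∃! c : ℕ, ∀ p : Framework.Realisation ℂ V, Framework.IsGeneric p →
      Framework.numClasses G p = c := by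
  refine ⟨fun p hp => hG.finite_congruenceClasses hp, ?_⟩
  obtain ⟨p₀, hp₀, -⟩ := hG
  -- Uniqueness of `c` needs a generic complex realisation to exist; the real one from rigidity
  -- supplies it.
  exact ⟨_, fun p hp => hp.numClasses_eq G hp₀.ofReal, fun c hc => (hc _ hp₀.ofReal).symm⟩
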